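/- Let $G$ be a finitely generated group, $H\subset G$ a finitely generated normal subgroup, and $\Gamma=G/H$. Assume that the induced map of profinite completions $\widehat H\to\widehat G$ is injective. Let $K$ be an algebraically closed field of characteristic zero and $V$ a finite-dimensional $K$-vector space. A representation $\rho$ of a group on a finite-dimensional $K$-vector space $U$ has finite determinant if the character $\det\circ\rho$ has finite image. It is called admissible if it is semisimple and all its simple constituents have finite determinant. A representation of a group $G'\supset H$ is called admissible relative to $H$ if it is admissible and all its simple constituents stay simple when restricted to $H$. The group $\Gamma$ acts on the set of isomorphism classes of representations of $H$ on $V$ by conjugation by lifts of elements of $\Gamma$ to $G$. Let $\rho_H\colon H\to\mathrm{GL}(V)$ be an admissible representation. Then the following conditions are equivalent: 1) the orbit $\Gamma\cdot[\rho_H]$ of the isomorphism class of $\rho_H$ is finite; 2) there are a subgroup $G'\subset G$ of finite index with $H\subset G'$ and a representation $\rho\colon G'\to\mathrm{GL}(V)$ with $\rho|_H=\rho_H$; 3) there are a subgroup $G'\subset G$ of finite index with $H\subset G'$ and a representation $\rho\colon G'\to\mathrm{GL}(V)$ that is admissible relative to $H$ and satisfies $\rho|_H=\rho_H$. -/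

import Mathlib

/-- The map of profinite completions induced by the inclusion of a subgroup `H` of `G` is
injective. -/
def ProfiniteCompletionInjective {G : Type*} [Group G] (H : Subgroup G) : Prop :=
  Function.Injective
    (ProfiniteGrp.profiniteCompletion.map (GrpCat.ofHom H.subtype)).hom

namespace Representation

section Admissible

variable {K G V : Type*} [Field K] [Group G] [AddCommGroup V] [Module K V]

/-- The character `det ∘ ρ` takes only finitely many values. -/
def HasFiniteDet (ρ : Representation K G V) : Prop :=
  (Set.range fun g : G => LinearMap.det (ρ g)).Finite

/-- A representation is admissible if it is semisimple and all its simple constituents have finite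
determinant. As `ρ` is semisimple, its simple constituents are, up to isomorphism, its irreducible
subrepresentations. -/
structure IsAdmissible (ρ : Representation K G V) : Prop where
  semisimple : ρ.IsSemisimpleRepresentation
  finiteDet : ∀ W : Subrepresentation ρ, W.toRepresentation.IsIrreducible →
    HasFiniteDet W.toRepresentation

/-- The restriction of a representation to a subgroup. -/
abbrev restrictSubgroup (ρ : Representation K G V) (N : Subgroup G) : Representation K N V :=
  ρ.comp N.subtype

/-- A representation of `G` is admissible relative to `N` if it is admissible and all its simple
constituents stay simple when restricted to `N`. -/
structure IsAdmissibleRel (ρ : Representation K G V) (N : Subgroup G) : Prop where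
  admissible : ρ.IsAdmissible
  irreducible_restrict : ∀ W : Subrepresentation ρ, W.toRepresentation.IsIrreducible →
    (W.toRepresentation.restrictSubgroup N).IsIrreducible

end Admissible

section IsoClass

variable (K H V : Type*) [Field K] [Group H] [AddCommGroup V] [Module K V]

/-- Isomorphism of representations on `V`, as an equivalence relation. -/
def isoSetoid : Setoid (Representation K H V) where
  r ρ σ := Nonempty (ρ.Equiv σ)
  iseqv :=
    { refl := fun ρ => ⟨Equiv.refl ρ⟩
      symm := fun ⟨e⟩ => ⟨e.symm⟩
      trans := fun ⟨e⟩ ⟨f⟩ => ⟨e.trans f⟩ }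

/-- The set of isomorphism classes of representations of `H` on `V`. -/
def IsoClass : Type _ := Quotient (isoSetoid K H V)

end IsoClass

section Action

variable {K G V : Type*} [Field K] [Group G] [AddCommGroup V] [Module K V] {H : Subgroup G}

/-- The isomorphism class of a representation. -/
def isoClass (ρ : Representation K H V) : IsoClass K H V :=
  Quotient.mk (isoSetoid K H V) ρ

variable [H.Normal]

/-- The conjugate of a representation `ρ` of a normal subgroup `H` by `g : G`, which is
`h ↦ ρ (g⁻¹ h g)`. -/
def conj (g : G) (ρ : Representation K H V) : Representation K H V :=
  ρ.comp (MulAut.conjNormal g⁻¹ : MulAut H).toMonoidHom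

theorem conj_apply (g : G) (ρ : Representation K H V) (h : H) :
    conj g ρ h = ρ ⟨g⁻¹ * h * g, by
      simpa using ‹H.Normal›.conj_mem h h.2 g⁻¹⟩ := by
  refine congrArg ρ (Subtype.ext ?_)
  simp

/-- `G` acts by conjugation on the isomorphism classes of representations of `H`. -/
instance : MulAction G (IsoClass K H V) where
  smul g := Quotient.map (sa := isoSetoid K H V) (sb := isoSetoid K H V) (conj g)
    fun _ _ ⟨e⟩ => ⟨Equiv.mk e.toLinearEquiv fun h => by
      ext v
      exact LinearMap.congr_fun (e.isIntertwining' (MulAut.conjNormal g⁻¹ h)) v⟩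
  one_smul x := by
    induction x using Quotient.inductionOn with
    | h ρ =>
      refine congrArg (Quotient.mk (isoSetoid K H V)) ?_
      ext h v
      simp [conj]
  mul_smul g g' x := by
    induction x using Quotient.inductionOn with
    | h ρ =>
      refine congrArg (Quotient.mk (isoSetoid K H V)) ?_
      ext h v
      simp [conj]

theorem smul_isoClass (g : G) (ρ : Representation K H V) :
    g • isoClass ρ = isoClass (conj g ρ) := rfl

/-- Elements of `H` act trivially on isomorphism classes, since `ρ h` is an isomorphism between
`ρ` and its conjugate by `h`. -/
theorem smul_isoClass_of_mem (g : G) (hg : g ∈ H) (x : IsoClass K H V) : g • x = x := by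
  induction x using Quotient.inductionOn with
  | h ρ =>
    refine Quotient.sound (s := isoSetoid K H V) ⟨Equiv.symm (Equiv.mk
      (LinearEquiv.ofLinearMap (ρ ⟨g, hg⟩⁻¹) (ρ ⟨g, hg⟩)
        (by rw [← Module.End.mul_eq_comp, ← map_mul]; simp; rfl)
        (by rw [← Module.End.mul_eq_comp, ← map_mul]; simp; rfl)) fun h => ?_)⟩
    change ρ ⟨g, hg⟩⁻¹ * ρ h = ρ (MulAut.conjNormal g⁻¹ h) * ρ ⟨g, hg⟩⁻¹
    rw [← map_mul, ← map_mul]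
    refine congrArg ρ (Subtype.ext ?_)
    simp [mul_assoc]

/-- The action of `Γ = G ⧸ H` on isomorphism classes of representations of `H`: an element of `Γ`
acts by conjugation by any of its lifts to `G`. -/
instance : MulAction (G ⧸ H) (IsoClass K H V) :=
  MulAction.compHom (IsoClass K H V)
    (QuotientGroup.lift H (MulAction.toPermHom G (IsoClass K H V)) fun g hg =>
      _root_.Equiv.ext (smul_isoClass_of_mem g hg))

theorem mk_smul_isoClass (g : G) (ρ : Representation K H V) :
    (g : G ⧸ H) • isoClass ρ = isoClass (conj g ρ) := rfl

/-- `ρH` extends to a representation of some subgroup `G'` of finite index in `G` containing `H`,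
such that the extension satisfies `P G'`. -/
def EssentiallyExtends (ρH : Representation K H V)
    (P : ∀ G' : Subgroup G, Representation K G' V → Prop) : Prop :=
  ∃ (G' : Subgroup G) (hle : H ≤ G'), G'.FiniteIndex ∧
    ∃ ρ : Representation K G' V, ρ.comp (Subgroup.inclusion hle) = ρH ∧ P G' ρ

end Action

end Representation

/-!
A representation `ρ` of a subgroup `G' ≥ H` which extends `ρH` provides the isomorphism `ρ g` of
`ρH` with its conjugate by each `g` in `G'`. So the stabilizer of the class of `ρH` contains `G'`,
and the orbit is finite if `G'` has finite index.

Conversely, let the orbit be finite, so that the stabilizer in `G` of the class of `ρH` has finite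
index. Conjugation by this stabilizer permutes the finitely many classes of simple constituents of
`ρH`, so each of these has a stabilizer of finite index too
(`finiteIndex_stabilizer_isoClass_toRepresentation`). It is enough to extend each summand of a
decomposition of `ρH` into irreducible representations to a subgroup of finite index, keeping the
determinant finite: on the intersection of these subgroups, the direct sum of the extensions
extends `ρH`, and each of its simple constituents is isomorphic to one of the summands.

So let `σ` be irreducible, with determinants of order dividing `N` and with a stabilizer of finite
index. The pairs `(g, A)`, where `A` is an isomorphism of the conjugate of `σ` by `g` with `σ` and
`det A ^ N = 1`, form a group `Λ` (`intertwiningGroup`). It projects onto a subgroup of finite index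
in `G`, because intertwiners can be rescaled to have determinant one; by Schur's lemma the kernel
is a finite group of scalars; and `h ↦ (h, σ h)` embeds `H` into `Λ`. An extension of `σ` amounts to
a section of the projection over a subgroup containing `H` that is the given one on `H`. Now `Λ` is
finitely generated, so by Malcev's theorem the linear representation `(g, A) ↦ A` of `Λ` yields a
normal subgroup `U` of finite index which meets the kernel trivially. As the map of profinite
completions is injective, the subgroup `U ∩ H` of finite index in `H` contains `H ∩ M` for a normal
subgroup `M` of finite index in `G`. If `U₁` denotes the preimage of `M` in `U`, then the subgroup
`H U₁` of `Λ` still meets the kernel trivially: if `h u` lies in the kernel, then `h` lies in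
`H ∩ M ⊆ U`, so `h u ∈ U` is trivial. Hence `H U₁` projects isomorphically to a subgroup of finite
index in `G`, and the second projection is the extension (`IsIrreducible.essentiallyExtends`).
-/

/-! ### Finitely generated linear groups -/

instance isJacobsonRing_int : IsJacobsonRing ℤ := by
  rw [isJacobsonRing_iff_prime_eq]
  intro P hP
  by_cases h : P = ⊥
  · subst h
    rw [eq_bot_iff]
    intro x hx
    rw [Ideal.mem_jacobson_bot] at hx
    -- if `x` is in the Jacobson radical, then `x * x + 1` is a unit, so that `x = 0`
    have := hx x
    rw [Int.isUnit_iff] at this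
    rw [Ideal.mem_bot]
    rcases this with h | h
    · exact mul_self_eq_zero.mp (by linarith)
    · nlinarith [mul_self_nonneg x]
  · exact Ideal.jacobson_eq_self_of_isMaximal (H := hP.isMaximal h)

/-- A field that is finitely generated as a ring is finite. -/
theorem finite_of_finiteType_int (k : Type*) [Field k] [Algebra.FiniteType ℤ k] : Finite k := by
  have hfin : Module.Finite ℤ k := finite_of_finite_type_of_isJacobsonRing ℤ k
  have hint : Algebra.IsIntegral ℤ k := inferInstance
  have htors : Module.IsTorsion ℤ k := by
    obtain ⟨p, hp⟩ := CharP.exists k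
    have hp0 : p ≠ 0 := by
      rintro rfl
      have : CharZero k := CharP.charP_to_charZero k
      exact Int.not_isField <| isField_of_isIntegral_of_isField
        (FaithfulSMul.algebraMap_injective ℤ k) (Field.toIsField k)
    intro x
    exact ⟨⟨p, mem_nonZeroDivisors_of_ne_zero (by exact_mod_cast hp0)⟩, by
      simp [Submonoid.smul_def]⟩
  exact Module.finite_of_fg_torsion k htors

/-- The residue fields of a finitely generated ring are finite. -/
theorem Ideal.IsMaximal.finite_quotient_of_finiteType_int {A : Type*} [CommRing A]
    [hA : Algebra.FiniteType ℤ A] {m : Ideal A} (hm : m.IsMaximal) : Finite (A ⧸ m) := by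
  let _ : Field (A ⧸ m) := Ideal.Quotient.field m
  have : Algebra.FiniteType ℤ (A ⧸ m) :=
    Algebra.FiniteType.of_surjective (Ideal.Quotient.mk m).toIntAlgHom Ideal.Quotient.mk_surjective
  exact @finite_of_finiteType_int (A ⧸ m) _ this

open Matrix in
/-- **Malcev's theorem**: finitely generated linear groups are residually finite. The entries of
the generators and of their inverses, together with the inverse of a nonzero entry of `f x - 1`,
generate a ring whose residue fields are finite. -/
theorem exists_finiteIndexNormalSubgroup_notMem_of_linear {Λ K n : Type*} [Group Λ] [Group.FG Λ]
    [Field K] [Fintype n] [DecidableEq n] (f : Λ →* GL n K) {x : Λ} (hx : f x ≠ 1) :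
    ∃ N : FiniteIndexNormalSubgroup Λ, x ∉ N := by
  obtain ⟨S, hS, hSfin⟩ := Group.fg_iff.mp ‹Group.FG Λ›
  obtain ⟨i, j, hij⟩ : ∃ i j, (f x : Matrix n n K) i j - (1 : Matrix n n K) i j ≠ 0 := by
    by_contra! h
    exact hx (Units.ext (Matrix.ext fun i j => sub_eq_zero.mp (h i j)))
  set d := (f x : Matrix n n K) i j - (1 : Matrix n n K) i j with hd
  let E : Set K := insert d⁻¹ (⋃ s ∈ S, ⋃ a, ⋃ b,
    {(f s : Matrix n n K) a b, ((f s)⁻¹ : GL n K).val a b})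
  have hE : E.Finite := Set.Finite.insert _ <| hSfin.biUnion fun s _ =>
    Set.finite_iUnion fun a => Set.finite_iUnion fun b => by simp
  let A := Algebra.adjoin ℤ E
  have hAfg : Algebra.FiniteType ℤ A :=
    (Subalgebra.fg_iff_finiteType A).mp (Subalgebra.fg_def.mpr ⟨E, hE, rfl⟩)
  let ι : GL n A →* GL n K := GeneralLinearGroup.map A.val.toRingHom
  have hmapinj : Function.Injective (fun M : Matrix n n A => M.map (fun a => (a : K))) :=
    fun M N h => Matrix.ext fun a b => Subtype.ext (congrFun (congrFun h a) b)
  have hι : Function.Injective ι := fun u v h => Units.ext (hmapinj (congrArg Units.val h))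
  have hrange : f.range ≤ ι.range := by
    rw [MonoidHom.range_eq_map, ← hS, MonoidHom.map_closure, Subgroup.closure_le]
    rintro _ ⟨s, hs, rfl⟩
    have h1 : ∀ a b, (f s : Matrix n n K) a b ∈ A := fun a b =>
      Algebra.subset_adjoin (Or.inr (by simp only [Set.mem_iUnion]; exact ⟨s, hs, a, b, by simp⟩))
    have h2 : ∀ a b, ((f s)⁻¹ : GL n K).val a b ∈ A := fun a b =>
      Algebra.subset_adjoin (Or.inr (by
        simp only [Set.mem_iUnion]; exact ⟨s, hs, a, b, Or.inr rfl⟩))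
    let M : Matrix n n A := fun a b => ⟨_, h1 a b⟩
    let M' : Matrix n n A := fun a b => ⟨_, h2 a b⟩
    have hmul : ∀ X Y : Matrix n n A, (X * Y).map A.val.toRingHom =
      X.map A.val.toRingHom * Y.map A.val.toRingHom := fun X Y => Matrix.map_mul
    have hone : (1 : Matrix n n A).map A.val.toRingHom = 1 :=
      Matrix.map_one _ (map_zero _) (map_one _)
    have e1 : M.map A.val.toRingHom = (f s).val := rfl
    have e2 : M'.map A.val.toRingHom = ((f s)⁻¹ : GL n K).val := rfl
    refine ⟨⟨M, M', hmapinj ?_, hmapinj ?_⟩, Units.ext rfl⟩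
    · change (M * M').map A.val.toRingHom = (1 : Matrix n n A).map A.val.toRingHom
      rw [hmul, hone, e1, e2, Units.mul_inv]
    · change (M' * M).map A.val.toRingHom = (1 : Matrix n n A).map A.val.toRingHom
      rw [hmul, hone, e1, e2, Units.inv_mul]
  let φ : Λ →* GL n A := (MonoidHom.ofInjective hι).symm.toMonoidHom.comp
    (f.codRestrict ι.range fun y => hrange ⟨y, rfl⟩)
  have hφ : ∀ y, ι (φ y) = f y := fun y =>
    congrArg Subtype.val ((MonoidHom.ofInjective hι).apply_symm_apply
      (f.codRestrict ι.range (fun y => hrange ⟨y, rfl⟩) y))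
  obtain ⟨m, hm⟩ := Ideal.exists_maximal A
  have : Finite (A ⧸ m) := hm.finite_quotient_of_finiteType_int
  let q : GL n A →* GL n (A ⧸ m) := GeneralLinearGroup.map (Ideal.Quotient.mk m)
  have : Finite (GL n (A ⧸ m)) := Finite.of_injective (fun u => u.val) fun _ _ => Units.ext
  refine ⟨.ofSubgroup (q.comp φ).ker, fun h => ?_⟩
  have h : q (φ x) = 1 := h
  have hij' := congrArg (fun u : GL n (A ⧸ m) => u.val i j) h
  have hmem : (φ x).val i j - (1 : Matrix n n A) i j ∈ m := by
    rw [← Ideal.Quotient.eq_zero_iff_mem, map_sub, sub_eq_zero]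
    refine Eq.trans hij' ?_
    simp only [Units.val_one, Matrix.one_apply]
    split_ifs <;> simp
  have hcoe : (((φ x).val i j - (1 : Matrix n n A) i j : A) : K) = d := by
    rw [hd, ← hφ x]
    simp only [AddSubgroupClass.coe_sub, Matrix.one_apply]
    congr 1
    split_ifs <;> rfl
  have hdA : d⁻¹ ∈ A := Algebra.subset_adjoin (Or.inl rfl)
  refine hm.ne_top ((Ideal.eq_top_iff_one m).mpr ?_)
  have := m.mul_mem_left ⟨d⁻¹, hdA⟩ hmem
  convert this
  apply Subtype.ext
  change (1 : K) = d⁻¹ * _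
  rw [hcoe, inv_mul_cancel₀ hij]

/-- An extension of a finitely generated group by a finite group is finitely generated. -/
theorem Group.fg_of_finite_ker {Λ G : Type*} [Group Λ] [Group G] (f : Λ →* G) [Finite f.ker]
    (hf : f.range.FG) : Group.FG Λ := by
  obtain ⟨S, hS, hSfin⟩ := (Subgroup.fg_iff _).mp hf
  obtain ⟨T, rfl, hinj⟩ := Set.exists_image_eq_injOn_of_subset_range (f := f) (t := S)
    (by rw [← MonoidHom.coe_range, ← hS]; exact Subgroup.subset_closure)
  have hT : T.Finite := Set.Finite.of_finite_image hSfin hinj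
  have hsup : Subgroup.closure T ⊔ f.ker = ⊤ := by
    rw [← Subgroup.comap_map_eq, MonoidHom.map_closure, hS]
    ext; simp
  rw [Group.fg_def, ← hsup]
  exact Subgroup.FG.sup ((Subgroup.fg_iff _).mpr ⟨T, rfl, hT⟩)
    ((Group.fg_iff_subgroup_fg _).mp inferInstance)

/-! ### Profinite completions -/

open ProfiniteGrp ProfiniteGrp.ProfiniteCompletion in
/-- If the map of profinite completions is injective, then the profinite topology of `G` induces
that of `H`. -/
theorem ProfiniteCompletionInjective.exists_forall_mem {G : Type*} [Group G] {H : Subgroup G}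
    (hinj : ProfiniteCompletionInjective H) (N : FiniteIndexNormalSubgroup H) :
    ∃ M : FiniteIndexNormalSubgroup G, ∀ h : H, (h : G) ∈ M → h ∈ N := by
  let F : completion (GrpCat.of H) →ₜ* completion (GrpCat.of G) :=
    (profiniteCompletion.map (GrpCat.ofHom H.subtype)).hom
  have hnat : ∀ h : H, F (etaFn (GrpCat.of H) h) = etaFn (GrpCat.of G) (h : G) := fun h =>
    CategoryTheory.ConcreteCategory.congr_hom
      (lift_eta (P := completion (GrpCat.of G))
        (CategoryTheory.CategoryStruct.comp (GrpCat.ofHom H.subtype) (eta (GrpCat.of G)))) h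
  have hemb : Topology.IsClosedEmbedding F :=
    F.continuous_toFun.isClosedEmbedding hinj
  let W : Set (completion (GrpCat.of H)) := {x | x.1 N = 1}
  have hW : IsOpen W := by
    have hc : Continuous fun x : completion (GrpCat.of H) => x.1 N :=
      (continuous_apply N).comp continuous_subtype_val
    have : DiscreteTopology ((diagram (GrpCat.of H)).obj N) := ⟨rfl⟩
    exact (isOpen_discrete {1}).preimage hc
  obtain ⟨O, hO, hOW⟩ := hemb.isInducing.isOpen_iff.mp hW
  have h1 : (1 : completion (GrpCat.of G)) ∈ O := by
    have : (1 : completion (GrpCat.of H)) ∈ F ⁻¹' O := by rw [hOW]; rfl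
    rwa [Set.mem_preimage, map_one] at this
  obtain ⟨M, hM⟩ := exist_openNormalSubgroup_sub_open_nhds_of_one hO h1
  refine ⟨preimage (eta (GrpCat.of G)) M, fun h hh => ?_⟩
  have hmem : etaFn (GrpCat.of H) h ∈ F ⁻¹' O := by
    rw [Set.mem_preimage, hnat]
    exact hM hh
  rw [hOW] at hmem
  exact (QuotientGroup.eq_one_iff h).mp hmem

/-! ### Irreducible representations and internal direct sums -/

universe v

namespace Representation

section Irreducible

variable {K G G' V U : Type*} [Field K] [Group G] [Group G'] [AddCommGroup V] [Module K V]
  [AddCommGroup U] [Module K U]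

theorem isIrreducible_iff (ρ : Representation K G V) :
    ρ.IsIrreducible ↔ Nontrivial V ∧
      ∀ S : Submodule K V, (∀ g, ∀ v ∈ S, ρ g v ∈ S) → S = ⊥ ∨ S = ⊤ := by
  constructor
  · intro h
    refine ⟨?_, fun S hS => ?_⟩
    · by_contra hV
      rw [not_nontrivial_iff_subsingleton] at hV
      exact bot_ne_top (α := Subrepresentation ρ)
        (Subrepresentation.toSubmodule_injective (Subsingleton.elim _ _))
    · exact (eq_bot_or_eq_top (⟨S, fun g v => hS g v⟩ : Subrepresentation ρ)).imp
        (congrArg Subrepresentation.toSubmodule) (congrArg Subrepresentation.toSubmodule)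
  · rintro ⟨hV, h⟩
    have : Nontrivial (Subrepresentation ρ) :=
      ⟨⊥, ⊤, fun e => bot_ne_top (α := Submodule K V) (congrArg Subrepresentation.toSubmodule e)⟩
    exact ⟨fun W => (h W.toSubmodule W.apply_mem_toSubmodule).imp
      (fun e => Subrepresentation.toSubmodule_injective e)
      (fun e => Subrepresentation.toSubmodule_injective e)⟩

theorem IsIrreducible.of_comp {ρ : Representation K G V} (f : G' →* G)
    (h : IsIrreducible (ρ.comp f)) : ρ.IsIrreducible := by
  rw [isIrreducible_iff] at h ⊢
  exact ⟨h.1, fun S hS => h.2 S fun g => hS (f g)⟩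

theorem IsIrreducible.comp_of_surjective {ρ : Representation K G V} (h : ρ.IsIrreducible)
    {f : G' →* G} (hf : Function.Surjective f) : IsIrreducible (ρ.comp f) := by
  rw [isIrreducible_iff] at h ⊢
  refine ⟨h.1, fun S hS => h.2 S fun g => ?_⟩
  obtain ⟨g, rfl⟩ := hf g
  exact hS g

theorem Equiv.isIrreducible {ρ : Representation K G V} {σ : Representation K G U} (e : ρ.Equiv σ)
    (h : ρ.IsIrreducible) : σ.IsIrreducible := by
  rw [isIrreducible_iff] at h ⊢
  have := h.1
  refine ⟨e.toLinearEquiv.symm.toEquiv.nontrivial, fun S hS => ?_⟩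
  refine (h.2 (S.comap e.toLinearEquiv.toLinearMap) fun g v hv => ?_).imp (fun h => ?_) fun h => ?_
  · have : e (ρ g v) = σ g (e v) := e.toIntertwiningMap.isIntertwining _ _ g v
    exact (this ▸ hS g _ hv : e (ρ g v) ∈ S)
  · rw [eq_bot_iff] at h ⊢
    intro x hx
    obtain ⟨v, rfl⟩ := e.toLinearEquiv.surjective x
    have : v = 0 := h hx
    simp [this]
  · rw [eq_top_iff] at h ⊢
    intro x _
    obtain ⟨v, rfl⟩ := e.toLinearEquiv.surjective x
    exact h (Submodule.mem_top (x := v))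

theorem Equiv.hasFiniteDet {ρ : Representation K G V} {σ : Representation K G U} (e : ρ.Equiv σ)
    (h : HasFiniteDet ρ) : HasFiniteDet σ := by
  unfold HasFiniteDet at h ⊢
  convert h using 3 with g
  rw [← e.conj_apply_self g]
  exact LinearMap.det_conj _ _

/-- Pulling back along a group homomorphism preserves isomorphisms. -/
def Equiv.compHom {ρ : Representation K G V} {σ : Representation K G U} (e : ρ.Equiv σ)
    (f : G' →* G) : Equiv (ρ.comp f) (σ.comp f) :=
  Equiv.mk e.toLinearEquiv fun g => e.isIntertwining' (f g)

theorem _root_.Subrepresentation.isIrreducible_iff_isAtom {ρ : Representation K G V}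
    (W : Subrepresentation ρ) : W.toRepresentation.IsIrreducible ↔ IsAtom W := by
  rw [isIrreducible_iff]
  constructor
  · rintro ⟨hnt, h⟩
    refine ⟨fun e => ?_, fun X hX => ?_⟩
    · subst e
      exact (Submodule.nontrivial_iff_ne_bot.mp hnt) rfl
    · apply Subrepresentation.toSubmodule_injective
      have hle : X.toSubmodule ≤ W.toSubmodule := hX.le
      rcases h (X.toSubmodule.comap W.toSubmodule.subtype)
        fun g v hv => X.apply_mem_toSubmodule g hv with h | h
      · change X.toSubmodule = ⊥
        rw [eq_bot_iff] at h ⊢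
        intro v hv
        have : (⟨v, hle hv⟩ : W.toSubmodule) = 0 := h hv
        exact congrArg Subtype.val this
      · rw [Submodule.comap_subtype_eq_top] at h
        exact absurd h (not_le_of_gt hX)
  · rintro ⟨hne, h⟩
    refine ⟨Submodule.nontrivial_iff_ne_bot.mpr
      fun e => hne (Subrepresentation.toSubmodule_injective e), fun S hS => ?_⟩
    let X : Subrepresentation ρ := ⟨S.map W.toSubmodule.subtype, fun g x hx => by
      obtain ⟨v, hv, rfl⟩ := hx
      exact ⟨_, hS g v hv, rfl⟩⟩
    have hX : X ≤ W := by
      rintro _ ⟨v, hv, rfl⟩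
      exact v.2
    rcases hX.eq_or_lt with e | e
    · right
      rw [eq_top_iff]
      intro v _
      have : (v : V) ∈ X := e.ge v.2
      obtain ⟨v', hv', e'⟩ := this
      rwa [← Subtype.ext e']
    · left
      have := congrArg Subrepresentation.toSubmodule (h X e)
      exact Submodule.map_injective_of_injective W.toSubmodule.injective_subtype
        (this.trans (Submodule.map_bot _).symm)

end Irreducible

section DirectSum

open DirectSum

variable {K G V U ι : Type*} [Field K] [Group G] [AddCommGroup V] [Module K V]
  [AddCommGroup U] [Module K U]

/-- A finite-dimensional semisimple representation is the internal direct sum of finitely many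
irreducible subrepresentations. -/
theorem exists_isInternal_isIrreducible {V : Type v} [AddCommGroup V] [Module K V]
    [FiniteDimensional K V] 
    (ρ : Representation K G V) (hρ : ρ.IsSemisimpleRepresentation) :
    ∃ (ι : Type v) (_ : Finite ι) (_ : DecidableEq ι) (W : ι → Subrepresentation ρ),
      (∀ i, (W i).toRepresentation.IsIrreducible) ∧
      DirectSum.IsInternal fun i => (W i).toSubmodule := by
  classical
  rw [isSemisimpleRepresentation_iff_isSemisimpleModule_asModule] at hρ
  obtain ⟨s, hind, hsup, hs⟩ := IsSemisimpleModule.exists_sSupIndep_sSup_simples_eq_top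
    (MonoidAlgebra K G) ρ.asModule
  let W : s → Subrepresentation ρ := fun m => Subrepresentation.ofSubmodule' m.1
  have hirr : ∀ m, (W m).toRepresentation.IsIrreducible := fun m => by
    rw [Subrepresentation.isIrreducible_iff_isAtom]
    exact (OrderIso.isAtom_iff Subrepresentation.subrepresentationSubmoduleOrderIso.symm _).mpr
      (isSimpleModule_iff_isAtom.mp (hs m m.2))
  have hint : DirectSum.IsInternal fun m : s => m.1 :=
    DirectSum.isInternal_submodule_of_iSupIndep_of_iSup_eq_top
      ((sSupIndep_iff s).mp hind) (by rw [← sSup_eq_iSup', hsup])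
  have hint' : DirectSum.IsInternal fun m => (W m).toSubmodule := hint
  refine ⟨s, ?_, inferInstance, W, hirr, hint'⟩
  exact WellFoundedGT.finite_of_iSupIndep hint'.submodule_iSupIndep fun m =>
    Submodule.nontrivial_iff_ne_bot.mp ((isIrreducible_iff _).mp (hirr m)).1

theorem isSemisimpleRepresentation_of_iSup_eq_top {ρ : Representation K G V}
    {W : ι → Subrepresentation ρ} (hW : ⨆ i, (W i).toSubmodule = ⊤)
    (hirr : ∀ i, (W i).toRepresentation.IsIrreducible) : ρ.IsSemisimpleRepresentation := by
  rw [isSemisimpleRepresentation_iff_isSemisimpleModule_asModule]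
  refine isSemisimpleModule_of_isSemisimpleModule_submodule'
    (p := fun i => (W i).asSubmodule) (fun i => ?_) ?_
  · have : IsSimpleModule (MonoidAlgebra K G) (W i).asSubmodule := by
      rw [isSimpleModule_iff_isAtom]
      exact (OrderIso.isAtom_iff Subrepresentation.subrepresentationSubmoduleOrderIso _).mpr
        ((W i).isIrreducible_iff_isAtom.mp (hirr i))
    infer_instance
  · have hle : ⨆ i, (W i).toSubmodule ≤
        (Subrepresentation.ofSubmodule' (⨆ i, (W i).asSubmodule)).toSubmodule :=
      iSup_le fun i => le_iSup (fun i => (W i).asSubmodule) i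
    rw [eq_top_iff]
    intro v _
    exact hle (hW ▸ Submodule.mem_top)

variable [DecidableEq ι]

/-- The representation on an internal direct sum which is given on each summand. -/
noncomputable def ofIsInternal {W : ι → Submodule K V} (hW : DirectSum.IsInternal W)
    (σ : ∀ i, Representation K G (W i)) : Representation K G V :=
  (LinearEquiv.ofBijective (coeLinearMap W) hW).conjRingEquiv.toMonoidHom.comp (directSum σ)

theorem ofIsInternal_apply {W : ι → Submodule K V} (hW : DirectSum.IsInternal W)
    (σ : ∀ i, Representation K G (W i)) (g : G) {i : ι} (w : W i) :
    ofIsInternal hW σ g w = σ i g w := by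
  have h : (LinearEquiv.ofBijective (coeLinearMap W) hW).symm w = lof K ι (fun i => W i) i w := by
    rw [LinearEquiv.symm_apply_eq]
    exact (coeLinearMap_lof W i w).symm
  change coeLinearMap W (DirectSum.lmap (fun i => σ i g)
    ((LinearEquiv.ofBijective (coeLinearMap W) hW).symm w)) = _
  rw [h, DirectSum.lmap_lof, coeLinearMap_lof]

/-- An irreducible representation with a nonzero map to an internal direct sum of irreducible
subrepresentations is isomorphic to one of them. -/
theorem exists_equiv_of_isInternal {ρ : Representation K G V} {W : ι → Subrepresentation ρ}
    (hW : DirectSum.IsInternal fun i => (W i).toSubmodule)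
    (hirr : ∀ i, (W i).toRepresentation.IsIrreducible) {τ : Representation K G U}
    (hτ : τ.IsIrreducible) (f : IntertwiningMap τ ρ) (hf : f ≠ 0) :
    ∃ i, Nonempty (τ.Equiv (W i).toRepresentation) := by
  let e := LinearEquiv.ofBijective (coeLinearMap fun i => (W i).toSubmodule) hW
  have he : ∀ g x, e (directSum (fun i => (W i).toRepresentation) g x) = ρ g (e x) := by
    intro g x
    induction x using DirectSum.induction_on with
    | zero => simp
    | of i x =>
      change coeLinearMap _ (DirectSum.lmap (fun i => (W i).toRepresentation g) (lof K ι (fun i => (W i).toSubmodule) i x)) =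
        ρ g (coeLinearMap _ (lof K ι (fun i => (W i).toSubmodule) i x))
      rw [DirectSum.lmap_lof, coeLinearMap_lof, coeLinearMap_lof]
      rfl
    | add x y hx hy => simp only [map_add, hx, hy]
  have he' : ∀ g v, e.symm (ρ g v) = directSum (fun i => (W i).toRepresentation) g (e.symm v) := by
    intro g v
    rw [LinearEquiv.symm_apply_eq, he, LinearEquiv.apply_symm_apply]
  let p : ∀ i, IntertwiningMap τ (W i).toRepresentation := fun i =>
    ⟨component K ι (fun i => (W i).toSubmodule) i ∘ₗ e.symm.toLinearMap ∘ₗ f.toLinearMap, fun g => by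
      ext1 v
      have hfv : f (τ g v) = ρ g (f v) := f.isIntertwining _ _ g v
      change e.symm (f (τ g v)) i = (W i).toRepresentation g (e.symm (f v) i)
      rw [hfv, he']
      rfl⟩
  obtain ⟨i, hi⟩ : ∃ i, p i ≠ 0 := by
    by_contra! h
    apply hf
    ext v
    refine e.symm.map_eq_zero_iff.mp (DFinsupp.ext fun i => ?_)
    exact congrArg (fun q : IntertwiningMap τ (W i).toRepresentation => q v) (h i)
  exact ⟨i, ⟨(p i).ofBijective ((IsIrreducible.bijective_or_eq_zero (p i)).resolve_right hi)⟩⟩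

end DirectSum

end Representation

/-! ### Extending irreducible representations -/

namespace Representation

section Extension

variable {K G W : Type*} [Field K] [Group G] [AddCommGroup W] [Module K W] {H : Subgroup G}

/-- The group of pairs `(g, A)` such that `A` intertwines `σ` and its conjugate by `g` and
`det A ^ N = 1`. If `σ` is irreducible, it is an extension of a subgroup of the stabilizer of the
isomorphism class of `σ` by a finite group of scalars. -/
def intertwiningGroup [H.Normal] (σ : Representation K H W) (N : ℕ) :
    Subgroup (G × (Module.End K W)ˣ) where
  carrier := {x | (∀ h : H, x.2.val * σ h = σ (MulAut.conjNormal x.1 h) * x.2.val) ∧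
    LinearMap.det x.2.val ^ N = 1}
  one_mem' := by simp
  mul_mem' := by
    rintro ⟨g, A⟩ ⟨g', A'⟩ ⟨h1, h2⟩ ⟨h1', h2'⟩
    refine ⟨fun h => ?_, ?_⟩
    · change A.val * A'.val * _ = _ * (A.val * A'.val)
      rw [mul_assoc, h1', ← mul_assoc, h1, mul_assoc]
      simp [map_mul]
    · simp only [Prod.mk_mul_mk, Units.val_mul, map_mul, mul_pow] at h2 h2' ⊢
      rw [h2, h2', one_mul]
  inv_mem' := by
    rintro ⟨g, A⟩ ⟨h1, h2⟩
    refine ⟨fun h => ?_, ?_⟩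
    · have := h1 (MulAut.conjNormal g⁻¹ h)
      simp only [map_inv, MulAut.apply_inv_self] at this
      simp only [Prod.inv_mk, map_inv]
      rw [Units.inv_mul_eq_iff_eq_mul, ← mul_assoc, this, mul_assoc, Units.mul_inv, mul_one]
    · have h3 : LinearMap.det A⁻¹.val * LinearMap.det A.val = 1 := by
        rw [← map_mul, Units.inv_mul, map_one]
      have := congrArg (· ^ N) h3
      simp only [mul_pow, h2, mul_one, one_pow] at this
      exact this

theorem mem_intertwiningGroup [H.Normal] {σ : Representation K H W} {N : ℕ}
    {x : G × (Module.End K W)ˣ} : x ∈ intertwiningGroup σ N ↔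
      (∀ h : H, x.2.val * σ h = σ (MulAut.conjNormal x.1 h) * x.2.val) ∧
        LinearMap.det x.2.val ^ N = 1 := Iff.rfl

/-- A representation of a group with finite determinant has determinants of bounded order. -/
theorem HasFiniteDet.exists_pow_eq_one {G : Type*} [Group G] {σ : Representation K G W}
    (h : HasFiniteDet σ) : ∃ N, 0 < N ∧ ∀ g, LinearMap.det (σ g) ^ N = 1 := by
  let f : G →* Kˣ := MonoidHom.toHomUnits ((LinearMap.det).comp σ)
  have hf : Finite f.range := by
    refine Set.Finite.to_subtype (Set.Finite.of_finite_image (f := Units.val)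
      (h.subset ?_) Units.val_injective.injOn)
    rintro _ ⟨_, ⟨g, rfl⟩, rfl⟩
    exact ⟨g, rfl⟩
  refine ⟨Nat.card f.range, Nat.card_pos, fun g => ?_⟩
  have := pow_card_eq_one' (x := (⟨f g, g, rfl⟩ : f.range))
  simpa [f] using congrArg (fun u : f.range => (u.1.val : K)) this

/-- A representation whose determinants have bounded order has finite determinant. -/
theorem hasFiniteDet_of_pow_eq_one {G : Type*} [Group G] {σ : Representation K G W} {N : ℕ}
    (hN : 0 < N) (h : ∀ g, LinearMap.det (σ g) ^ N = 1) : HasFiniteDet σ := by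
  classical
  refine (Polynomial.nthRoots N (1 : K)).toFinset.finite_toSet.subset ?_
  rintro _ ⟨g, rfl⟩
  simpa [Polynomial.mem_nthRoots hN] using h g

variable [H.Normal]

/-- The projection `(g, A) ↦ g`. -/
def intertwiningGroup.toGroup (σ : Representation K H W) (N : ℕ) : intertwiningGroup σ N →* G :=
  (MonoidHom.fst G (Module.End K W)ˣ).comp (intertwiningGroup σ N).subtype

/-- The projection `(g, A) ↦ A`. -/
def intertwiningGroup.toUnits (σ : Representation K H W) (N : ℕ) :
    intertwiningGroup σ N →* (Module.End K W)ˣ :=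
  (MonoidHom.snd G (Module.End K W)ˣ).comp (intertwiningGroup σ N).subtype

/-- The embedding `h ↦ (h, σ h)`. -/
def intertwiningGroup.ofSubgroup (σ : Representation K H W) {N : ℕ}
    (hN : ∀ h, LinearMap.det (σ h) ^ N = 1) : H →* intertwiningGroup σ N :=
  (H.subtype.prod (MonoidHom.toHomUnits σ)).codRestrict _ fun h => by
    refine ⟨fun h' => ?_, hN h⟩
    change σ h * σ h' = σ (MulAut.conjNormal (h : G) h') * σ h
    rw [← map_mul, ← map_mul]
    exact congrArg σ (Subtype.ext (by simp))

variable [IsAlgClosed K] [FiniteDimensional K W]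

open intertwiningGroup

/-- By Schur's lemma, the elements of `intertwiningGroup σ N` over `1` are scalars, of order
dividing `N * finrank K W`. -/
theorem finite_ker_toGroup {σ : Representation K H W} (hσ : σ.IsIrreducible) {N : ℕ}
    (hN : 0 < N) : Finite (toGroup σ N).ker := by
  classical
  have hnt : Nontrivial W := ((isIrreducible_iff σ).mp hσ).1
  set n := Module.finrank K W
  have hn0 : 0 < n := Module.finrank_pos
  let R := (Polynomial.nthRoots (n * N) (1 : K)).toFinset
  have key : ∀ x : (toGroup σ N).ker, ∃ c : R, (toUnits σ N x.1).val = c.1 • 1 := by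
    rintro ⟨⟨⟨g, A⟩, hA⟩, rfl : g = 1⟩
    obtain ⟨h1, h2⟩ := hA
    let f : IntertwiningMap σ σ := ⟨A.val, fun h => by simpa using! h1 h⟩
    obtain ⟨c, hc⟩ := (IsIrreducible.algebraMap_intertwiningMap_bijective_of_isAlgClosed
      (ρ := σ)).2 f
    have hc' : A.val = c • (1 : Module.End K W) :=
      (congrArg IntertwiningMap.toLinearMap hc).symm
    refine ⟨⟨c, ?_⟩, hc'⟩
    change LinearMap.det A.val ^ N = 1 at h2
    rw [hc', LinearMap.det_smul, map_one, mul_one, ← pow_mul] at h2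
    simpa [R, Polynomial.mem_nthRoots (Nat.mul_pos hn0 hN)] using h2
  choose c hc using key
  refine Finite.of_injective c fun x y hxy => ?_
  have h2 : toUnits σ N x.1 = toUnits σ N y.1 := Units.ext (by rw [hc, hc, hxy])
  exact Subtype.ext (Subtype.ext (Prod.ext (Eq.trans x.2 (Eq.symm y.2)) h2))

/-- Every element of the stabilizer of the isomorphism class of `σ` has an intertwiner, which can be
rescaled to have determinant one. -/
theorem stabilizer_le_range_toGroup [Nontrivial W] (σ : Representation K H W) (N : ℕ) :
    MulAction.stabilizer G (isoClass σ) ≤ (toGroup σ N).range := by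
  intro g hg
  obtain ⟨e⟩ : Nonempty ((conj g σ).Equiv σ) := Quotient.exact hg
  have hdet : LinearMap.det e.toLinearEquiv.toLinearMap ≠ 0 :=
    (LinearEquiv.isUnit_det' e.toLinearEquiv).ne_zero
  obtain ⟨c, hc⟩ := IsAlgClosed.exists_pow_nat_eq (LinearMap.det e.toLinearEquiv.toLinearMap)
    (Module.finrank_pos (R := K) (M := W))
  have hc0 : c ≠ 0 := by
    rintro rfl
    rw [zero_pow Module.finrank_pos.ne'] at hc
    exact hdet hc.symm
  let A : (Module.End K W)ˣ := (Units.mk0 c hc0)⁻¹ • LinearMap.GeneralLinearGroup.ofLinearEquiv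
    e.toLinearEquiv
  have hA : A.val = c⁻¹ • e.toLinearEquiv.toLinearMap := rfl
  refine ⟨⟨(g, A), fun h => ?_, ?_⟩, rfl⟩
  · have := e.isIntertwining' (MulAut.conjNormal g h)
    have hcj : conj g σ (MulAut.conjNormal g h) = σ h := by
      change σ (MulAut.conjNormal g⁻¹ (MulAut.conjNormal g h)) = _
      simp
    rw [hcj] at this
    simp only [hA]
    rw [smul_mul_assoc, mul_smul_comm]
    exact congrArg _ this
  · simp only [hA]
    rw [LinearMap.det_smul, ← hc, ← mul_pow, inv_mul_cancel₀ hc0, one_pow, one_pow]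

/-- An irreducible representation of `H` with finite determinant whose isomorphism class has a
stabilizer of finite index in `G` extends to a representation with finite determinant of a subgroup
of finite index: residual finiteness of linear groups and injectivity of the map of profinite
completions give a subgroup of finite index of `intertwiningGroup` which contains `H` and meets the
kernel of the projection to `G` trivially. -/
theorem IsIrreducible.essentiallyExtends [Group.FG G] (hinj : ProfiniteCompletionInjective H)
    {σ : Representation K H W} (hσ : σ.IsIrreducible) (hdet : HasFiniteDet σ)
    (hstab : (MulAction.stabilizer G (isoClass σ)).FiniteIndex) :
    σ.EssentiallyExtends fun _ τ => HasFiniteDet τ := by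
  have hnt : Nontrivial W := ((isIrreducible_iff σ).mp hσ).1
  obtain ⟨N, hN, hNdet⟩ := hdet.exists_pow_eq_one
  let π := toGroup σ N
  let ι := ofSubgroup σ hNdet
  have hπι : ∀ h, π (ι h) = h := fun h => rfl
  have hker : Finite π.ker := finite_ker_toGroup hσ hN
  have hrange : π.range.FiniteIndex := Subgroup.finiteIndex_of_le (stabilizer_le_range_toGroup σ N)
  have hfg : Group.FG (intertwiningGroup σ N) :=
    Group.fg_of_finite_ker π ((Group.fg_iff_subgroup_fg _).mp inferInstance)
  -- a normal subgroup `U` of finite index meeting the kernel trivially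
  have hsep : ∀ k : {k : π.ker // k ≠ 1},
      ∃ U : FiniteIndexNormalSubgroup (intertwiningGroup σ N), k.1.1 ∉ U := by
    rintro ⟨k, hk⟩
    let b := Module.finBasis K W
    let m : (Module.End K W)ˣ ≃* Matrix.GeneralLinearGroup (Fin (Module.finrank K W)) K :=
      Units.mapEquiv (LinearMap.toMatrixAlgEquiv b).toMulEquiv
    refine exists_finiteIndexNormalSubgroup_notMem_of_linear (m.toMonoidHom.comp (toUnits σ N))
      fun h => hk ?_
    have h2 : toUnits σ N k.1 = 1 := m.map_eq_one_iff.mp h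
    exact Subtype.ext (Subtype.ext (Prod.ext k.2 h2))
  choose U hU using hsep
  let U₀ : Subgroup (intertwiningGroup σ N) := ⨅ k, (U k).toSubgroup
  have hU₀n : U₀.Normal := Subgroup.normal_iInf_normal fun k => inferInstance
  have hU₀f : U₀.FiniteIndex := Subgroup.finiteIndex_iInf fun k => inferInstance
  have hU₀ : ∀ x ∈ U₀, π x = 1 → x = 1 := by
    intro x hx hx1
    by_contra hne
    exact hU ⟨⟨x, hx1⟩, fun h => hne (congrArg Subtype.val h)⟩ (Subgroup.mem_iInf.mp hx _)
  -- shrink `U₀` so that the elements of `H` over which it has a point lie in it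
  obtain ⟨M, hM⟩ := hinj.exists_forall_mem ((FiniteIndexNormalSubgroup.ofSubgroup U₀).comap ι)
  let U₁ : Subgroup (intertwiningGroup σ N) := U₀ ⊓ (M.comap π).toSubgroup
  have hU₁n : U₁.Normal := inferInstance
  have hU₁f : U₁.FiniteIndex := inferInstance
  let P := ι.range ⊔ U₁
  have hPf : P.FiniteIndex := Subgroup.finiteIndex_of_le (le_sup_right (a := ι.range) (b := U₁))
  have hinjP : Function.Injective (π.comp P.subtype) := by
    rw [injective_iff_map_eq_one]
    rintro ⟨x, hx⟩ (hx1 : π x = 1)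
    obtain ⟨_, ⟨h, rfl⟩, u, hu, rfl⟩ := Subgroup.mem_sup_of_normal_right.mp hx
    rw [map_mul, hπι] at hx1
    have hhM : ((h⁻¹ : H) : G) ∈ M := by
      have : ((h⁻¹ : H) : G) = π u := inv_eq_of_mul_eq_one_right hx1
      rw [this]
      exact hu.2
    have hhU : ι h ∈ U₀ := by
      have : ι h⁻¹ ∈ U₀ := hM _ hhM
      simpa using this
    exact Subtype.ext (hU₀ _ (U₀.mul_mem hhU hu.1) (by rw [map_mul, hπι, hx1]))
  let e := MonoidHom.ofInjective hinjP
  have hrangeP : (π.comp P.subtype).range = P.map π := by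
    rw [MonoidHom.range_comp, Subgroup.range_subtype]
  have hHP : ∀ h, ι h ∈ P := fun h => (le_sup_left : ι.range ≤ P) ⟨h, rfl⟩
  have hle : H ≤ (π.comp P.subtype).range := fun h hh => ⟨⟨ι ⟨h, hh⟩, hHP _⟩, rfl⟩
  refine ⟨(π.comp P.subtype).range, hle, ?_,
    (Units.coeHom _).comp (((toUnits σ N).comp P.subtype).comp e.symm.toMonoidHom), ?_, ?_⟩
  · rw [hrangeP]
    have := Subgroup.finiteIndex_of_le (le_sup_left : P ≤ P ⊔ π.ker)
    exact ⟨by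
      rw [Subgroup.index_map]
      exact mul_ne_zero Subgroup.FiniteIndex.index_ne_zero hrange.index_ne_zero⟩
  · refine MonoidHom.ext fun h => ?_
    have : e.symm (Subgroup.inclusion hle h) =
        ⟨ι h, hHP h⟩ := by
      rw [MulEquiv.symm_apply_eq]
      rfl
    change (toUnits σ N (e.symm (Subgroup.inclusion hle h)).1).val = _
    rw [this]
    rfl
  · exact hasFiniteDet_of_pow_eq_one hN fun g => (e.symm g).1.2.2

end Extension

end Representation

/-! ### Orbits, stabilizers and extensions of semisimple representations -/

namespace Representation

section Semisimple

variable {K G V : Type*} [Field K] [Group G] [AddCommGroup V] [Module K V] {H : Subgroup G}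
  [H.Normal]

theorem finite_orbit_iff_finiteIndex_stabilizer (x : IsoClass K H V) :
    (MulAction.orbit (G ⧸ H) x).Finite ↔ (MulAction.stabilizer G x).FiniteIndex := by
  have : MulAction.orbit (G ⧸ H) x = MulAction.orbit G x :=
    (QuotientGroup.mk_surjective (s := H)).range_comp (fun q : G ⧸ H => q • x) |>.symm
  rw [this, Subgroup.finiteIndex_iff, MulAction.index_stabilizer]
  exact ⟨fun h => ((Set.ncard_pos h).mpr (MulAction.nonempty_orbit x)).ne',
    Set.finite_of_ncard_ne_zero⟩

/-- The operators of an extension of `ρH` to `G'` are isomorphisms between `ρH` and its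
conjugates. -/
theorem le_stabilizer_of_comp_inclusion_eq {ρH : Representation K H V} {G' : Subgroup G}
    (hle : H ≤ G') {ρ : Representation K G' V} (hρ : ρ.comp (Subgroup.inclusion hle) = ρH) :
    G' ≤ MulAction.stabilizer G (isoClass ρH) := by
  intro g hg
  refine Quotient.sound (s := isoSetoid K H V) ⟨Equiv.mk
    (LinearMap.GeneralLinearGroup.toLinearEquiv (MonoidHom.toHomUnits ρ ⟨g, hg⟩)) fun h => ?_⟩
  subst hρ
  change ρ ⟨g, hg⟩ * ρ (Subgroup.inclusion hle (MulAut.conjNormal g⁻¹ h)) =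
    ρ (Subgroup.inclusion hle h) * ρ ⟨g, hg⟩
  rw [← map_mul, ← map_mul]
  refine congrArg ρ (Subtype.ext ?_)
  simp [mul_assoc]

/-- If the isomorphism class of a semisimple representation has a stabilizer of finite index, so do
those of its simple constituents: up to isomorphism, the stabilizer permutes the finitely many
constituents. -/
theorem finiteIndex_stabilizer_isoClass_toRepresentation {ι : Type*} [Finite ι] [DecidableEq ι]
    {ρ : Representation K H V} {W : ι → Subrepresentation ρ}
    (hW : DirectSum.IsInternal fun i => (W i).toSubmodule)
    (hirr : ∀ i, (W i).toRepresentation.IsIrreducible)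
    (hstab : (MulAction.stabilizer G (isoClass ρ)).FiniteIndex) (i : ι) :
    (MulAction.stabilizer G (isoClass (W i).toRepresentation)).FiniteIndex := by
  let S := MulAction.stabilizer G (isoClass ρ)
  let T := MulAction.stabilizer G (isoClass (W i).toRepresentation)
  have hj : ∀ g : S, ∃ j,
      Nonempty ((conj (g : G) (W i).toRepresentation).Equiv (W j).toRepresentation) := by
    rintro ⟨g, hg⟩
    obtain ⟨e⟩ : Nonempty ((conj g ρ).Equiv ρ) := Quotient.exact hg
    have hirr' : (conj g (W i).toRepresentation).IsIrreducible :=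
      (hirr i).comp_of_surjective (MulAut.conjNormal g⁻¹ : MulAut H).surjective
    have hnt := ((isIrreducible_iff _).mp (hirr i)).1
    refine exists_equiv_of_isInternal hW hirr hirr'
      ⟨e.toLinearEquiv.toLinearMap ∘ₗ (W i).toSubmodule.subtype, fun h => ?_⟩ fun h0 => ?_
    · ext v
      exact LinearMap.congr_fun (e.isIntertwining' h) v.1
    · obtain ⟨v, hv⟩ := exists_ne (0 : (W i).toSubmodule)
      refine hv (Subtype.ext (e.toLinearEquiv.map_eq_zero_iff.mp ?_))
      exact congrArg (fun q : IntertwiningMap _ ρ => q v) h0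
  choose j hj using hj
  have hfin : Finite (S ⧸ T.subgroupOf S) := by
    refine Finite.of_injective (fun q => j q.out) fun q q' h => ?_
    rw [← q.out_eq', ← q'.out_eq']
    refine QuotientGroup.eq.mpr ?_
    obtain ⟨e⟩ := hj q.out
    obtain ⟨e'⟩ : Nonempty ((conj (q'.out : G) (W i).toRepresentation).Equiv
      (W (j q.out)).toRepresentation) := by
      rw [show j q.out = j q'.out from h]
      exact hj q'.out
    have heq : (q.out : G) • isoClass (W i).toRepresentation =
        (q'.out : G) • isoClass (W i).toRepresentation :=
      Quotient.sound (s := isoSetoid K H _) ⟨e.trans e'.symm⟩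
    change (q.out : G)⁻¹ * (q'.out : G) ∈ T
    rw [MulAction.mem_stabilizer_iff, mul_smul, ← heq, inv_smul_smul]
  have hfi : (T.subgroupOf S).FiniteIndex := Subgroup.finiteIndex_of_finite_quotient
  have : ((T.subgroupOf S).map S.subtype).FiniteIndex := ⟨by
    rw [Subgroup.index_map_subtype]
    exact mul_ne_zero hfi.index_ne_zero hstab.index_ne_zero⟩
  exact Subgroup.finiteIndex_of_le (by
    rw [Subgroup.subgroupOf_map_subtype]
    exact inf_le_left : (T.subgroupOf S).map S.subtype ≤ T)

/-- An admissible representation of `H` whose isomorphism class has a stabilizer of finite index in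
`G` extends to a subgroup of finite index, by extending the summands of a decomposition into
irreducible representations. -/
theorem IsAdmissible.essentiallyExtends [Group.FG G] [IsAlgClosed K] [FiniteDimensional K V]
    (hinj : ProfiniteCompletionInjective H) {ρH : Representation K H V} (hρH : ρH.IsAdmissible)
    (hstab : (MulAction.stabilizer G (isoClass ρH)).FiniteIndex) :
    ρH.EssentiallyExtends fun G' ρ => ρ.IsAdmissibleRel (H.subgroupOf G') := by
  obtain ⟨ι, _, _, W, hirr, hW⟩ := exists_isInternal_isIrreducible ρH hρH.semisimple
  have hext : ∀ i, (W i).toRepresentation.EssentiallyExtends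
      (G := G) fun _ τ => HasFiniteDet τ := fun i =>
    (hirr i).essentiallyExtends hinj (hρH.finiteDet (W i) (hirr i))
      (finiteIndex_stabilizer_isoClass_toRepresentation hW hirr hstab i)
  choose G' hle hfin τ hτ hdet using hext
  let G₀ : Subgroup G := ⨅ i, G' i
  have hle₀ : H ≤ G₀ := le_iInf hle
  let σ : ∀ i, Representation K G₀ (W i).toSubmodule := fun i =>
    (τ i).comp (Subgroup.inclusion (iInf_le G' i))
  have hσ : ∀ i, (σ i).comp (Subgroup.inclusion hle₀) = (W i).toRepresentation := hτ
  have hσdet : ∀ i, HasFiniteDet (σ i) := fun i =>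
    (hdet i).subset (Set.range_comp_subset_range (Subgroup.inclusion (iInf_le G' i))
      fun g => LinearMap.det (τ i g))
  have hσirr : ∀ i, IsIrreducible ((σ i).restrictSubgroup (H.subgroupOf G₀)) := fun i => by
    refine IsIrreducible.of_comp (Subgroup.subgroupOfEquivOfLe hle₀).symm.toMonoidHom ?_
    have h := hirr i
    rw [← hσ i] at h
    exact h
  let ρ := ofIsInternal hW σ
  have hρ : ∀ g i (w : (W i).toSubmodule), ρ g w = σ i g w := fun g i w =>
    ofIsInternal_apply hW σ g w
  let W' : ι → Subrepresentation ρ := fun i => ⟨(W i).toSubmodule, fun g v hv => by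
    rw [hρ g i ⟨v, hv⟩]
    exact (σ i g ⟨v, hv⟩).2⟩
  have e : ∀ i, (W' i).toRepresentation.Equiv (σ i) := fun i =>
    Equiv.mk (LinearEquiv.refl K (W i).toSubmodule) fun g => LinearMap.ext fun w =>
      Subtype.ext (hρ g i w)
  have hirr' : ∀ i, (W' i).toRepresentation.IsIrreducible := fun i =>
    (e i).symm.isIrreducible (IsIrreducible.of_comp _ (hσirr i))
  have hsub : ∀ X : Subrepresentation ρ, X.toRepresentation.IsIrreducible →
      ∃ i, Nonempty (X.toRepresentation.Equiv (σ i)) := by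
    intro X hX
    have hnt := ((isIrreducible_iff _).mp hX).1
    obtain ⟨i, ⟨f⟩⟩ := exists_equiv_of_isInternal (W := W') hW hirr' hX
      ⟨X.toSubmodule.subtype, fun g => rfl⟩ fun h0 => by
        obtain ⟨v, hv⟩ := exists_ne (0 : X.toSubmodule)
        exact hv (Subtype.ext (congrArg (fun q : IntertwiningMap _ ρ => q v) h0))
    exact ⟨i, ⟨f.trans (e i)⟩⟩
  refine ⟨G₀, hle₀, Subgroup.finiteIndex_iInf hfin, ρ, ?_, ⟨?_, fun X hX => ?_⟩, fun X hX => ?_⟩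
  · refine MonoidHom.ext fun h => LinearMap.ext fun v => ?_
    have hv : v ∈ ⨆ i, (W i).toSubmodule := hW.submodule_iSup_eq_top ▸ Submodule.mem_top
    induction hv using Submodule.iSup_induction' with
    | mem i v hv =>
      refine (hρ _ i ⟨v, hv⟩).trans ?_
      exact congrArg (fun q : Representation K H (W i).toSubmodule => (q h ⟨v, hv⟩ : V)) (hσ i)
    | zero => rw [map_zero, map_zero]
    | add x y _ _ hx hy => rw [map_add, map_add, hx, hy]
  · exact isSemisimpleRepresentation_of_iSup_eq_top (W := W') hW.submodule_iSup_eq_top hirr'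
  · obtain ⟨i, ⟨f⟩⟩ := hsub X hX
    exact f.symm.hasFiniteDet (hσdet i)
  · obtain ⟨i, ⟨f⟩⟩ := hsub X hX
    exact (f.symm.compHom _).isIrreducible (hσirr i)

end Semisimple

end Representation

theorem proposition4p6
    {K G V : Type*} [Field K] [CharZero K] [IsAlgClosed K]
    [Group G] [Group.FG G]
    (H : Subgroup G) [H.Normal] [Group.FG H]
    [AddCommGroup V] [Module K V] [FiniteDimensional K V]
    (hinj : ProfiniteCompletionInjective H)
    (ρH : Representation K H V) (hρH : ρH.IsAdmissible) :
    List.TFAE [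
      (MulAction.orbit (G ⧸ H) (Representation.isoClass ρH)).Finite,
      ρH.EssentiallyExtends fun _ _ => True,
      ρH.EssentiallyExtends fun G' ρ => ρ.IsAdmissibleRel (H.subgroupOf G')] := by
  rw [Representation.finite_orbit_iff_finiteIndex_stabilizer]
  tfae_have 1 → 3 := hρH.essentiallyExtends hinj
  tfae_have 3 → 2 := fun ⟨G', hle, hfin, ρ, hρ, _⟩ => ⟨G', hle, hfin, ρ, hρ, trivial⟩
  tfae_have 2 → 1 := fun ⟨_, hle, _, _, hρ, _⟩ =>
    Subgroup.finiteIndex_of_le (Representation.le_stabilizer_of_comp_inclusion_eq hle hρ)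
  tfae_finish
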